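/- All graphs are finite and simple. A linear forest is a disjoint union of paths, and for an integer $k\ge 0$ a graph $G$ is called $k$-edge-Hamiltonian if every set of at most $k$ edges of $G$ that forms a linear forest is contained in the edge set of some Hamilton cycle of $G$. The spectral radius $\lambda(G)$ is the largest eigenvalue of the adjacency matrix of $G$, and $\delta(G)$ is the minimum degree of $G$. Write $K_s$ for the complete graph on $s$ vertices, $I_t$ for the edgeless graph on $t$ vertices, $\cup$ for the disjoint union of graphs, and $\vee$ for the join (the disjoint union together with all edges between the two vertex sets). Put \[ H_{n,k,\delta} = K_\delta \vee (K_{n-2\delta+k}\cup I_{\delta-k}), \qquad L_{n,k,\delta} = K_{k+1}\vee (K_{n-\delta-1}\cup K_{\delta-k}). \] Theorem. Let $k\ge 0$ and $\delta\ge k+2$ be integers. There is an integer $N=N(k,\delta)$ such that for every $n\ge N$ the following holds: if $G$ is an $n$-vertex graph with $\delta(G)\ge\delta$ and \[ \lambda(G)\ge n-\delta+k-1, \] then $G$ is $k$-edge-Hamiltonian, or $G$ is isomorphic to $H_{n,k,\delta}$, or $G$ is isomorphic to $L_{n,k,\delta}$. -/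

import Mathlib

/-- The join of two vertex-disjoint graphs: their disjoint union together with all edges between
the two vertex sets. -/
def graphJoin {V W : Type*} (G : SimpleGraph V) (H : SimpleGraph W) : SimpleGraph (V ⊕ W) :=
  SimpleGraph.sum G H ⊔ completeBipartiteGraph V W

/-- `H_{n,k,δ} = K_δ ∨ (K_{n-2δ+k} ∪ I_{δ-k})`; it has `n` vertices when
`k ≤ δ` and `2δ ≤ n + k`. -/
def graphH (n k δ : ℕ) : SimpleGraph (Fin δ ⊕ (Fin (n + k - 2 * δ) ⊕ Fin (δ - k))) :=
  graphJoin (⊤ : SimpleGraph (Fin δ))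
    (SimpleGraph.sum (⊤ : SimpleGraph (Fin (n + k - 2 * δ))) (⊥ : SimpleGraph (Fin (δ - k))))

/-- `L_{n,k,δ} = K_{k+1} ∨ (K_{n-δ-1} ∪ K_{δ-k})`; it has `n` vertices when
`k ≤ δ` and `δ + 1 ≤ n`. -/
def graphL (n k δ : ℕ) : SimpleGraph (Fin (k + 1) ⊕ (Fin (n - δ - 1) ⊕ Fin (δ - k))) :=
  graphJoin (⊤ : SimpleGraph (Fin (k + 1)))
    (SimpleGraph.sum (⊤ : SimpleGraph (Fin (n - δ - 1))) (⊤ : SimpleGraph (Fin (δ - k))))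

/-- The adjacency spectral radius: the largest real root of the characteristic polynomial of the
adjacency matrix (all the roots are real, as the matrix is symmetric). -/
noncomputable def adjSpectralRadius {V : Type*} [Fintype V] [DecidableEq V]
    (G : SimpleGraph V) [DecidableRel G.Adj] : ℝ :=
  sSup {x : ℝ | (G.adjMatrix ℝ).charpoly.IsRoot x}

/-- A linear forest, i.e. a disjoint union of paths: an acyclic graph in which
every vertex has degree at most two. -/
def IsLinearForest {V : Type*} (F : SimpleGraph V) : Prop :=
  F.IsAcyclic ∧ ∀ v, (F.neighborSet v).encard ≤ 2

/-- `G` is `k`-edge-Hamiltonian: every set of at most `k` edges of `G` that forms a linear forest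
is contained in the edge set of some Hamilton cycle of `G`. -/
def IsKEdgeHamiltonian {V : Type*} [DecidableEq V] (k : ℕ) (G : SimpleGraph V) : Prop :=
  ∀ S : Finset (Sym2 V), (S : Set (Sym2 V)) ⊆ G.edgeSet → S.card ≤ k →
    IsLinearForest (SimpleGraph.fromEdgeSet (S : Set (Sym2 V))) →
    ∃ (v : V) (c : G.Walk v v), c.IsHamiltonianCycle ∧ ∀ e ∈ S, e ∈ c.edges

/-! Write c = δ - k, so that λ(G) ≥ n - c - 1, the spectral radius of a clique on n - c vertices.
Suppose that a linear forest F of at most k edges lies on no Hamilton cycle of G, and let H ⊇ G be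
edge-maximal with this property. Nonadjacent vertices of H are the ends of a Hamilton path of H
through F, and the crossing argument bounds their degree sum by n - 1 + k
(`exists_isHamPath_of_maximal`, `IsHamPath.degree_add_degree`). Since λ² is at most the degree sum,
H misses only O(n) edges. Hence H is a clique outside a bounded set T of vertices of bounded degree
(`isClique_high_degree`).

The eigenvector of G carries little weight on T, and this gives |T| ≤ c (`card_low_degree_le`). T is
not empty, because a complete graph has a Hamilton cycle through F. For nonadjacent u ∈ T and v ∉ T,
the bounds deg u ≥ δ and deg v ≥ n - |T| - 1 now meet the bound on the sum: |T| = c, deg u = δ, and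
v has no neighbour in T. So all of T has the same neighbourhood N outside T, and T induces a regular
graph. Pósa rotations of the tight Hamilton paths show that this graph is complete or empty
(`exists_full_or_isolated`); the two cases are L and H of the theorem.

Finally G is the maximal graph itself: at T the minimum degree leaves no edge to remove, and outside
T a missing edge would make λ too small (`adj_of_eigenvector`). -/

/-! ### The spectral radius and its eigenvector -/

/-- The weak Perron–Frobenius theorem: taking absolute values in an eigenvector z does not decrease
the Rayleigh quotient, which is already maximal. -/
theorem exists_nonneg_eigenvector {V : Type*} [Fintype V] [DecidableEq V] (G : SimpleGraph V)
    [DecidableRel G.Adj] (h : 0 < adjSpectralRadius G) :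
    ∃ x : V → ℝ, (∀ v, 0 ≤ x v) ∧ x ≠ 0 ∧
      ∀ v, ∑ w ∈ G.neighborFinset v, x w = adjSpectralRadius G * x v := by
  set l := adjSpectralRadius G with hl
  set A := G.adjMatrix ℝ with hA
  set S : Set ℝ := {x : ℝ | A.charpoly.IsRoot x} with hS
  have hfin : S.Finite := Polynomial.finite_setOfPred_isRoot (Matrix.charpoly_monic A).ne_zero
  -- The supremum of the empty set is 0 by convention, which positivity rules out.
  have hne : S.Nonempty := by
    by_contra hn
    rw [Set.not_nonempty_iff_eq_empty] at hn
    have : l = 0 := by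
      rw [hl]; unfold adjSpectralRadius
      rw [← hA, ← hS, hn, Real.sSup_empty]
    linarith
  have hmem : l ∈ S := hne.csSup_mem hfin
  have hmax : ∀ m ∈ S, m ≤ l := fun m hm => le_csSup hfin.bddAbove hm
  have eig : ∀ m : ℝ, m ∈ S ↔ ∃ y : V → ℝ, y ≠ 0 ∧ A.mulVec y = m • y := by
    intro m
    rw [hS, Set.mem_ofPred_eq, Polynomial.IsRoot.def, Matrix.eval_charpoly,
      ← Matrix.exists_mulVec_eq_zero_iff]
    refine exists_congr fun y => and_congr_right fun _ => ?_
    rw [Matrix.sub_mulVec, sub_eq_zero]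
    simp [Matrix.scalar_apply, eq_comm, ← Matrix.smul_one_eq_diagonal, Matrix.smul_mulVec]
  have hherm : (l • (1 : Matrix V V ℝ) - A).IsHermitian := by
    rw [Matrix.IsHermitian, Matrix.conjTranspose_eq_transpose_of_trivial]
    simp [hA]
  -- An eigenvalue e of l - A gives the eigenvalue l - e of A, which is at most l.
  have hpsd : (l • (1 : Matrix V V ℝ) - A).PosSemidef := by
    rw [hherm.posSemidef_iff_eigenvalues_nonneg]
    intro i
    have h1 := hherm.mulVec_eigenvectorBasis i
    have h2 : (hherm.eigenvectorBasis i).ofLp ≠ 0 := by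
      have := hherm.eigenvectorBasis.orthonormal.ne_zero i
      simpa using this
    have := hmax (l - hherm.eigenvalues i) ((eig _).2 ⟨_, h2, by
      rw [Matrix.sub_mulVec, Matrix.smul_mulVec, Matrix.one_mulVec] at h1
      rw [sub_smul, ← h1]; abel⟩)
    simp only [Pi.zero_apply]; linarith
  obtain ⟨z, hz0, hz⟩ := (eig l).1 hmem
  have hAv : ∀ (y : V → ℝ) v, A.mulVec y v = ∑ w ∈ G.neighborFinset v, y w := by
    intro y v; rw [hA, SimpleGraph.adjMatrix_mulVec_apply]
  refine ⟨fun v => |z v|, fun v => abs_nonneg _, ?_, ?_⟩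
  · intro h0
    exact hz0 (funext fun v => abs_eq_zero.1 (congrFun h0 v))
  · set y : V → ℝ := fun v => |z v| with hy
    have hle : ∀ v, l * y v ≤ A.mulVec y v := by
      intro v
      have : l * y v = |A.mulVec z v| := by
        rw [hz]; simp [hy, abs_mul, abs_of_pos h]
      rw [this, hAv, hAv]
      exact Finset.abs_sum_le_sum_abs _ _
    -- A y ≥ l y entrywise and y ≥ 0, so the semidefinite form of l - A is nonpositive at y. It
    -- therefore vanishes there, and y is in the kernel.
    have hzero : (l • (1 : Matrix V V ℝ) - A).mulVec y = 0 := by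
      rw [← hpsd.dotProduct_mulVec_zero_iff]
      apply le_antisymm _ (hpsd.dotProduct_mulVec_nonneg y)
      simp only [dotProduct]
      apply Finset.sum_nonpos
      intro v _
      apply mul_nonpos_of_nonneg_of_nonpos
      · simp [hy]
      · rw [Matrix.sub_mulVec, Matrix.smul_mulVec, Matrix.one_mulVec]
        simpa using hle v
    intro v
    have := congrFun hzero v
    rw [Matrix.sub_mulVec, Matrix.smul_mulVec, Matrix.one_mulVec] at this
    simp only [Pi.sub_apply, Pi.smul_apply, smul_eq_mul, Pi.zero_apply] at this
    rw [← hAv]; linarith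

/-- Cauchy–Schwarz in the eigenvalue equation at v gives (l x v)² ≤ deg v · ∑ x²; sum over v. -/
theorem sq_le_sum_degree_of_eigenvector {V : Type*} [Fintype V] (G : SimpleGraph V)
    [DecidableRel G.Adj] {l : ℝ} {x : V → ℝ} (hx : x ≠ 0)
    (h : ∀ v, ∑ w ∈ G.neighborFinset v, x w = l * x v) :
    l ^ 2 ≤ ∑ v, (G.degree v : ℝ) := by
  have hpos : 0 < ∑ v, x v ^ 2 := by
    obtain ⟨v, hv⟩ := Function.ne_iff.1 hx
    exact Finset.sum_pos' (fun _ _ => sq_nonneg _) ⟨v, Finset.mem_univ _, by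
      have : x v ≠ 0 := hv
      positivity⟩
  have key : l ^ 2 * ∑ v, x v ^ 2 ≤ (∑ v, (G.degree v : ℝ)) * ∑ v, x v ^ 2 := by
    rw [Finset.mul_sum, Finset.sum_mul]
    refine Finset.sum_le_sum fun v _ => ?_
    rw [← mul_pow, ← h v]
    refine sq_sum_le_card_mul_sum_sq.trans ?_
    rw [SimpleGraph.card_neighborFinset_eq_degree]
    gcongr
    exact Finset.subset_univ _
  exact le_of_mul_le_mul_right key hpos

/-! ### Hamilton paths through a set of edges: rotation and crossing -/

/-- `p 0, …, p (n - 1)`, with `n` the number of vertices, is a Hamilton path of `G` all of whose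
consecutive pairs together contain the set `F` of pairs. -/
structure IsHamPath {V : Type*} [Fintype V] (G : SimpleGraph V) (F : Finset (Sym2 V))
    (p : ℕ → V) : Prop where
  inj : ∀ i < Fintype.card V, ∀ j < Fintype.card V, p i = p j → i = j
  surj : ∀ v, ∃ i < Fintype.card V, p i = v
  adj : ∀ i, i + 1 < Fintype.card V → G.Adj (p i) (p (i + 1))
  cov : ∀ e ∈ F, ∃ i, i + 1 < Fintype.card V ∧ e = s(p i, p (i + 1))

/-- Some Hamilton path of `G` through `F` has adjacent ends. -/
def HasHamCycle {V : Type*} [Fintype V] (G : SimpleGraph V) (F : Finset (Sym2 V)) : Prop :=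
  ∃ p, IsHamPath G F p ∧ G.Adj (p (Fintype.card V - 1)) (p 0)

/-- The sequence `p` with the first `j + 1` terms reversed. -/
def reversePrefix {V : Type*} (p : ℕ → V) (j : ℕ) (i : ℕ) : V := if i ≤ j then p (j - i) else p i

section reversePrefix
variable {V : Type*} (p : ℕ → V) (j : ℕ)

theorem reversePrefix_of_le {i : ℕ} (h : i ≤ j) : reversePrefix p j i = p (j - i) := if_pos h

theorem reversePrefix_of_lt {i : ℕ} (h : j < i) : reversePrefix p j i = p i :=
  if_neg (by omega)

theorem reversePrefix_zero : reversePrefix p j 0 = p j := if_pos (Nat.zero_le j)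

end reversePrefix

namespace IsHamPath

variable {V : Type*} [Fintype V] {G : SimpleGraph V} {F : Finset (Sym2 V)} {p : ℕ → V}

/-- Pósa rotation. -/
theorem reversePrefix (h : IsHamPath G F p) {j : ℕ} (hj : j + 1 < Fintype.card V)
    (hadj : G.Adj (p 0) (p (j + 1))) (hF : s(p j, p (j + 1)) ∉ F) :
    IsHamPath G F (reversePrefix p j) where
  inj a ha b hb hab := by
    unfold _root_.reversePrefix at hab
    split_ifs at hab
    · have := h.inj _ (by omega) _ (by omega) hab; omega
    · have := h.inj _ (by omega) _ (by omega) hab; omega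
    · have := h.inj _ (by omega) _ (by omega) hab; omega
    · exact h.inj _ (by omega) _ (by omega) hab
  surj v := by
    obtain ⟨i, hi, rfl⟩ := h.surj v
    by_cases hij : i ≤ j
    · exact ⟨j - i, by omega, by rw [reversePrefix_of_le _ _ (by omega), Nat.sub_sub_self hij]⟩
    · exact ⟨i, hi, reversePrefix_of_lt _ _ (by omega)⟩
  adj i hi := by
    rcases lt_trichotomy i j with hij | rfl | hij
    · rw [reversePrefix_of_le _ _ hij.le, reversePrefix_of_le _ _ (by omega),
        show j - i = j - (i + 1) + 1 by omega]
      exact (h.adj _ (by omega)).symm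
    · rw [reversePrefix_of_le _ _ le_rfl, reversePrefix_of_lt _ _ (by omega), Nat.sub_self]
      exact hadj
    · rw [reversePrefix_of_lt _ _ hij, reversePrefix_of_lt _ _ (by omega)]
      exact h.adj _ hi
  cov e he := by
    obtain ⟨i, hi, rfl⟩ := h.cov e he
    rcases lt_trichotomy i j with hij | rfl | hij
    · refine ⟨j - (i + 1), by omega, ?_⟩
      rw [reversePrefix_of_le _ _ (by omega), reversePrefix_of_le _ _ (by omega), Sym2.eq_swap,
        show j - (j - (i + 1)) = i + 1 by omega, show j - (j - (i + 1) + 1) = i by omega]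
    · exact absurd he hF
    · refine ⟨i, hi, ?_⟩
      rw [reversePrefix_of_lt _ _ hij, reversePrefix_of_lt _ _ (by omega)]

/-- The path read from position `j + 1` on, and then through its closing pair from the start. -/
theorem rotate (h : IsHamPath G F p) {G' : SimpleGraph V} {j : ℕ} (hj : j + 1 < Fintype.card V)
    (hG : ∀ i, i + 1 < Fintype.card V → i ≠ j → G'.Adj (p i) (p (i + 1)))
    (hclose : G'.Adj (p (Fintype.card V - 1)) (p 0)) (hF : s(p j, p (j + 1)) ∉ F) :
    IsHamPath G' F (fun i => p (if i + (j + 1) < Fintype.card V then i + (j + 1)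
      else i + (j + 1) - Fintype.card V)) where
  inj a ha b hb hab := by
    have := h.inj _ (by split_ifs <;> omega) _ (by split_ifs <;> omega) hab
    split_ifs at this <;> omega
  surj v := by
    obtain ⟨i, hi, rfl⟩ := h.surj v
    by_cases hij : j + 1 ≤ i
    · exact ⟨i - (j + 1), by omega, by
        congr 1; rw [if_pos (by omega)]; omega⟩
    · exact ⟨i + Fintype.card V - (j + 1), by omega, by
        congr 1; rw [if_neg (by omega)]; omega⟩
  adj i hi := by
    rcases lt_trichotomy (i + (j + 1) + 1) (Fintype.card V) with hij | hij | hij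
    · rw [if_pos (by omega), if_pos (by omega), show i + 1 + (j + 1) = i + (j + 1) + 1 by omega]
      exact hG _ hij (by omega)
    · rw [if_pos (by omega), if_neg (by omega),
        show i + (j + 1) = Fintype.card V - 1 by omega,
        show i + 1 + (j + 1) - Fintype.card V = 0 by omega]
      exact hclose
    · rw [if_neg (by omega), if_neg (by omega),
        show i + 1 + (j + 1) - Fintype.card V = i + (j + 1) - Fintype.card V + 1 by omega]
      exact hG _ (by omega) (by omega)
  cov e he := by
    obtain ⟨i, hi, rfl⟩ := h.cov e he
    rcases lt_trichotomy i j with hij | rfl | hij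
    · refine ⟨i + Fintype.card V - (j + 1), by omega, ?_⟩
      rw [if_neg (by omega), if_neg (by omega),
        show i + Fintype.card V - (j + 1) + (j + 1) - Fintype.card V = i by omega,
        show i + Fintype.card V - (j + 1) + 1 + (j + 1) - Fintype.card V = i + 1 by omega]
    · exact absurd he hF
    · refine ⟨i - (j + 1), by omega, ?_⟩
      rw [if_pos (by omega), if_pos (by omega), show i - (j + 1) + (j + 1) = i by omega,
        show i - (j + 1) + 1 + (j + 1) = i + 1 by omega]

/-- The crossing argument. -/
theorem mem_of_crossing (h : IsHamPath G F p) (hno : ¬ HasHamCycle G F) {i : ℕ}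
    (hi : i + 1 < Fintype.card V) (h0 : G.Adj (p 0) (p (i + 1)))
    (h1 : G.Adj (p i) (p (Fintype.card V - 1))) : s(p i, p (i + 1)) ∈ F := by
  by_contra hF
  refine hno ⟨_, h.reversePrefix hi h0 hF, ?_⟩
  rw [reversePrefix_zero, reversePrefix_of_lt _ _ (by omega)]
  exact h1.symm

/-- Different positions of a path carry different pairs, so each edge of F permits at most one
crossing. -/
theorem crossing_card_le [DecidableEq V] (h : IsHamPath G F p) :
    ((Finset.range (Fintype.card V - 1)).filter fun i => s(p i, p (i + 1)) ∈ F).card ≤ F.card := by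
  refine Finset.card_le_card_of_injOn (fun i => s(p i, p (i + 1)))
    (fun i hi => (Finset.mem_filter.1 hi).2) ?_
  intro a ha b hb hab
  have ha' := Finset.mem_range.1 (Finset.mem_filter.1 ha).1
  have hb' := Finset.mem_range.1 (Finset.mem_filter.1 hb).1
  rcases Sym2.eq_iff.1 hab with ⟨h1, -⟩ | ⟨h1, h2⟩
  · exact h.inj _ (by omega) _ (by omega) h1
  · have := h.inj _ (by omega) _ (by omega) h1
    have := h.inj _ (by omega) _ (by omega) h2
    omega

variable [DecidableRel G.Adj]

theorem card_filter_adj_first (h : IsHamPath G F p) :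
    ((Finset.range (Fintype.card V - 1)).filter fun i => G.Adj (p 0) (p (i + 1))).card
      = G.degree (p 0) := by
  rw [← SimpleGraph.card_neighborFinset_eq_degree]
  refine Finset.card_bij (fun i _ => p (i + 1)) ?_ ?_ ?_
  · intro i hi
    simpa using (Finset.mem_filter.1 hi).2
  · intro a ha b hb hab
    have ha' := Finset.mem_range.1 (Finset.mem_filter.1 ha).1
    have hb' := Finset.mem_range.1 (Finset.mem_filter.1 hb).1
    have := h.inj _ (by omega) _ (by omega) hab
    omega
  · intro w hw
    rw [SimpleGraph.mem_neighborFinset] at hw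
    obtain ⟨i, hi, rfl⟩ := h.surj w
    have : i ≠ 0 := by rintro rfl; exact G.loopless.irrefl _ hw
    refine ⟨i - 1, ?_, ?_⟩
    · rw [Finset.mem_filter, Finset.mem_range, Nat.sub_add_cancel (by omega)]
      exact ⟨by omega, hw⟩
    · rw [Nat.sub_add_cancel (by omega)]

theorem card_filter_adj_last (h : IsHamPath G F p) :
    ((Finset.range (Fintype.card V - 1)).filter
      fun i => G.Adj (p i) (p (Fintype.card V - 1))).card = G.degree (p (Fintype.card V - 1)) := by
  rw [← SimpleGraph.card_neighborFinset_eq_degree]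
  refine Finset.card_bij (fun i _ => p i) ?_ ?_ ?_
  · intro i hi
    simpa [SimpleGraph.adj_comm] using (Finset.mem_filter.1 hi).2
  · intro a ha b hb hab
    have ha' := Finset.mem_range.1 (Finset.mem_filter.1 ha).1
    have hb' := Finset.mem_range.1 (Finset.mem_filter.1 hb).1
    exact h.inj _ (by omega) _ (by omega) hab
  · intro w hw
    rw [SimpleGraph.mem_neighborFinset] at hw
    obtain ⟨i, hi, rfl⟩ := h.surj w
    have : i ≠ Fintype.card V - 1 := by rintro rfl; exact G.loopless.irrefl _ hw
    refine ⟨i, ?_, rfl⟩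
    rw [Finset.mem_filter, Finset.mem_range]
    exact ⟨by omega, hw.symm⟩

/-- Degree sum of the ends of a Hamilton path that does not close up, with the equality case. -/
theorem degree_add_degree (h : IsHamPath G F p) (hno : ¬ HasHamCycle G F) {k : ℕ}
    (hk : F.card ≤ k) :
    G.degree (p 0) + G.degree (p (Fintype.card V - 1)) ≤ Fintype.card V - 1 + k ∧
    (Fintype.card V - 1 + k ≤ G.degree (p 0) + G.degree (p (Fintype.card V - 1)) →
      (∀ i, i + 1 < Fintype.card V →
        G.Adj (p 0) (p (i + 1)) ∨ G.Adj (p i) (p (Fintype.card V - 1))) ∧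
      ∀ i, i + 1 < Fintype.card V → s(p i, p (i + 1)) ∈ F →
        G.Adj (p 0) (p (i + 1)) ∧ G.Adj (p i) (p (Fintype.card V - 1))) := by
  classical
  set n := Fintype.card V
  set A := (Finset.range (n - 1)).filter fun i => G.Adj (p 0) (p (i + 1)) with hA
  set B := (Finset.range (n - 1)).filter fun i => G.Adj (p i) (p (n - 1)) with hB
  set C := (Finset.range (n - 1)).filter fun i => s(p i, p (i + 1)) ∈ F with hC
  have hcA : A.card = _ := h.card_filter_adj_first
  have hcB : B.card = _ := h.card_filter_adj_last
  have hcC : C.card ≤ F.card := h.crossing_card_le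
  -- A position in both sets is a crossing, hence carries an edge of F. So |A| + |B| = |A ∪ B| + |A
  -- ∩ B| ≤ (n - 1) + k, and equality forces A ∪ B to be everything and A ∩ B = C.
  have hsub : A ∩ B ⊆ C := by
    intro i hi
    simp only [hA, hB, hC, Finset.mem_inter, Finset.mem_filter, Finset.mem_range] at hi ⊢
    exact ⟨hi.1.1, h.mem_of_crossing hno (by omega) hi.1.2 hi.2.2⟩
  have hun : A ∪ B ⊆ Finset.range (n - 1) :=
    Finset.union_subset (Finset.filter_subset _ _) (Finset.filter_subset _ _)
  have h1 := Finset.card_union_add_card_inter A B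
  have h2 := Finset.card_le_card hsub
  have h3 := Finset.card_le_card hun
  rw [Finset.card_range] at h3
  rw [← hcA, ← hcB]
  refine ⟨by omega, fun hge => ⟨fun i hi => ?_, fun i hi hF => ?_⟩⟩
  · have := Finset.eq_of_subset_of_card_le hun (by rw [Finset.card_range]; omega)
    have hmem : i ∈ A ∪ B := this ▸ Finset.mem_range.2 (by omega)
    rcases Finset.mem_union.1 hmem with h' | h'
    · exact Or.inl (Finset.mem_filter.1 h').2
    · exact Or.inr (Finset.mem_filter.1 h').2
  · have := Finset.eq_of_subset_of_card_le hsub (by omega)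
    have hmem : i ∈ A ∩ B := this ▸ Finset.mem_filter.2 ⟨Finset.mem_range.2 (by omega), hF⟩
    rw [Finset.mem_inter] at hmem
    exact ⟨(Finset.mem_filter.1 hmem.1).2, (Finset.mem_filter.1 hmem.2).2⟩

end IsHamPath

/-! ### Edge-maximal graphs without a Hamilton cycle through F -/

/-- In a graph that is edge-maximal without a Hamilton cycle through `F`, any two nonadjacent
vertices are joined by a Hamilton path through `F`. -/
theorem exists_isHamPath_of_maximal {V : Type*} [Fintype V] {G : SimpleGraph V}
    {F : Finset (Sym2 V)} (hn3 : 3 ≤ Fintype.card V) (hF : (F : Set (Sym2 V)) ⊆ G.edgeSet)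
    (hmax : Maximal (fun H => ¬ HasHamCycle H F) G) {u v : V} (huv : u ≠ v) (hadj : ¬ G.Adj u v) :
    ∃ p, IsHamPath G F p ∧ p 0 = u ∧ p (Fintype.card V - 1) = v := by
  set n := Fintype.card V with hn
  -- a path with ends `u` and `v` in either order is enough
  suffices h : ∃ p, IsHamPath G F p ∧ s(p 0, p (n - 1)) = s(u, v) by
    obtain ⟨p, hp, he⟩ := h
    rcases Sym2.eq_iff.1 he with ⟨h1, h2⟩ | ⟨h1, h2⟩
    · exact ⟨p, hp, h1, h2⟩
    · refine ⟨fun i => p (n - 1 - i), ⟨?_, ?_, ?_, ?_⟩, by simpa using h2, by simpa using h1⟩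
      · intro a ha b hb hab
        have := hp.inj _ (by omega) _ (by omega) hab
        omega
      · intro w
        obtain ⟨i, hi, rfl⟩ := hp.surj w
        exact ⟨n - 1 - i, by omega, by rw [show n - 1 - (n - 1 - i) = i by omega]⟩
      · intro i hi
        have := (hp.adj (n - 1 - (i + 1)) (by omega)).symm
        rwa [show n - 1 - (i + 1) + 1 = n - 1 - i by omega] at this
      · intro e he
        obtain ⟨i, hi, rfl⟩ := hp.cov e he
        refine ⟨n - 1 - (i + 1), by omega, ?_⟩
        rw [Sym2.eq_swap]
        congr 3 <;> omega
  have hlt : G < G ⊔ SimpleGraph.edge u v := by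
    refine lt_of_le_of_ne le_sup_left fun he => hadj ?_
    rw [he]
    simp [SimpleGraph.edge_adj, huv]
  have hcyc : HasHamCycle (G ⊔ SimpleGraph.edge u v) F := by
    by_contra hno
    exact hmax.not_prop_of_gt hlt hno
  have hG' : ∀ a b, (G ⊔ SimpleGraph.edge u v).Adj a b → s(a, b) ≠ s(u, v) → G.Adj a b := by
    intro a b hab hne
    rw [SimpleGraph.sup_adj, SimpleGraph.edge_adj] at hab
    rcases hab with hab | ⟨hab, -⟩
    · exact hab
    · exact absurd (Sym2.eq_iff.2 hab) hne
  have huvF : s(u, v) ∉ F := fun h => hadj (hF h)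
  obtain ⟨p, hp, hc⟩ := hcyc
  by_cases hint : ∃ j, j + 1 < n ∧ s(p j, p (j + 1)) = s(u, v)
  · obtain ⟨j, hj, he⟩ := hint
    have hne : ∀ i, i + 1 < n → i ≠ j → s(p i, p (i + 1)) ≠ s(u, v) := by
      intro i hi hij h
      rw [← he] at h
      rcases Sym2.eq_iff.1 h with ⟨h1, -⟩ | ⟨h1, h2⟩
      · exact hij (hp.inj _ (by omega) _ (by omega) h1)
      · have := hp.inj _ (by omega) _ (by omega) h1
        have := hp.inj _ (by omega) _ (by omega) h2
        omega
    -- The pair uv cannot be both a consecutive pair and the closing pair, as there are at least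
    -- three vertices.
    by_cases hce : s(p (n - 1), p 0) = s(u, v)
    · rw [← he] at hce
      rcases Sym2.eq_iff.1 hce with ⟨h1, h2⟩ | ⟨h1, h2⟩
      · have := hp.inj _ (by omega) _ (by omega) h1
        omega
      · have := hp.inj _ (by omega) _ (by omega) h1
        have := hp.inj _ (by omega) _ (by omega) h2
        omega
    -- Opening the cycle at uv instead of at its closing pair leaves a path that lies in G.
    · refine ⟨_, hp.rotate (G' := G) hj (fun i hi hij => hG' _ _ (hp.adj i hi) (hne i hi hij))
        (hG' _ _ hc hce) (he ▸ huvF), ?_⟩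
      rw [← he, Sym2.eq_swap, if_neg (by omega), if_pos (by omega), Nat.zero_add,
        show n - 1 + (j + 1) - Fintype.card V = j by omega]
  · push Not at hint
    refine ⟨p, ⟨hp.inj, hp.surj, fun i hi => hG' _ _ (hp.adj i hi) (hint i hi), hp.cov⟩, ?_⟩
    by_contra hce
    refine hmax.prop ⟨p, ⟨hp.inj, hp.surj, fun i hi => hG' _ _ (hp.adj i hi) (hint i hi), hp.cov⟩,
      hG' _ _ hc ?_⟩
    rwa [Sym2.eq_swap]

/-- With at least three vertices the closing edge is not an edge of the path, so closing the path
gives a genuine cycle. -/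
theorem HasHamCycle.exists_isHamiltonianCycle {V : Type*} [Fintype V] [DecidableEq V]
    {G : SimpleGraph V} {F : Finset (Sym2 V)} (hn : 3 ≤ Fintype.card V) (h : HasHamCycle G F) :
    ∃ (v : V) (c : G.Walk v v), c.IsHamiltonianCycle ∧ ∀ e ∈ F, e ∈ c.edges := by
  obtain ⟨p, hp, hc⟩ := h
  have hw : ∀ j < Fintype.card V, ∃ w : G.Walk (p 0) (p j),
      w.support = (List.range (j + 1)).map p ∧
      w.edges = (List.range j).map fun i => s(p i, p (i + 1)) := by
    intro j
    induction j with
    | zero => exact fun _ => ⟨.nil, by simp, by simp⟩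
    | succ j ih =>
      intro hj
      obtain ⟨w, hs, he⟩ := ih (by omega)
      refine ⟨w.concat (hp.adj j hj), ?_, ?_⟩
      · rw [SimpleGraph.Walk.support_concat, hs, List.range_succ (n := j + 1)]; simp
      · rw [SimpleGraph.Walk.edges_concat, he, List.range_succ (n := j)]; simp
  obtain ⟨w, hs, he⟩ := hw (Fintype.card V - 1) (by omega)
  have hpath : w.IsPath := by
    rw [SimpleGraph.Walk.isPath_def, hs]
    refine List.Nodup.map_on ?_ List.nodup_range
    intro a ha b hb hab
    rw [List.mem_range] at ha hb
    exact hp.inj _ (by omega) _ (by omega) hab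
  refine ⟨_, .cons hc w, ⟨?_, ?_⟩, ?_⟩
  · rw [SimpleGraph.Walk.cons_isCycle_iff]
    refine ⟨hpath, ?_⟩
    rw [he, List.mem_map]
    rintro ⟨i, hi, h⟩
    rw [List.mem_range] at hi
    rcases Sym2.eq_iff.1 h with ⟨h1, -⟩ | ⟨h1, h2⟩
    · have := hp.inj _ (by omega) _ (by omega) h1
      omega
    · have := hp.inj _ (by omega) _ (by omega) h1
      have := hp.inj _ (by omega) _ (by omega) h2
      omega
  · have : w.IsHamiltonian := hpath.isHamiltonian_of_mem fun v => by
      obtain ⟨i, hi, rfl⟩ := hp.surj v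
      rw [hs, List.mem_map]
      exact ⟨i, List.mem_range.2 (by omega), rfl⟩
    intro a
    simpa using this a
  · intro e hF
    obtain ⟨i, hi, rfl⟩ := hp.cov e hF
    rw [SimpleGraph.Walk.edges_cons, he]
    exact List.mem_cons_of_mem _ (List.mem_map.2 ⟨i, List.mem_range.2 (by omega), rfl⟩)

/-! ### Linear forests in the complete graph -/

/-- Serves to follow consecutive pairs while one entry of a list is moved: only the pair at the seam
can change. -/
theorem List.pair_infix_append_iff {α : Type*} {x y : α} {A B : List α} :
    [x, y] <:+: A ++ B ↔
      [x, y] <:+: A ∨ [x, y] <:+: B ∨ (∃ A', A = A' ++ [x]) ∧ ∃ B', B = y :: B' := by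
  constructor
  · rintro ⟨s, t, h⟩
    rw [List.append_assoc, List.append_eq_append_iff] at h
    rcases h with ⟨a, rfl, h⟩ | ⟨a, rfl, h⟩
    · rcases a with _ | ⟨a1, _ | ⟨a2, a⟩⟩
      · exact Or.inr (Or.inl ⟨[], t, by simpa using h⟩)
      · simp only [List.cons_append, List.nil_append, List.cons.injEq] at h
        exact Or.inr (Or.inr ⟨⟨s, by simp [h.1]⟩, t, h.2.symm⟩)
      · simp only [List.cons_append, List.nil_append, List.cons.injEq] at h
        exact Or.inl ⟨s, a, by simp [h.1, h.2.1]⟩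
    · exact Or.inr (Or.inl ⟨a, t, by simp [h]⟩)
  · rintro (⟨s, t, rfl⟩ | ⟨s, t, rfl⟩ | ⟨⟨A', rfl⟩, B', rfl⟩)
    · exact ⟨s, t ++ B, by simp⟩
    · exact ⟨A ++ s, t, by simp⟩
    · exact ⟨A', B', by simp⟩

theorem List.pair_infix_append_of_insert {α : Type*} {x y a : α} {A B : List α}
    (h : [x, y] <:+: A ++ a :: B) (hx : x ≠ a) (hy : y ≠ a) : [x, y] <:+: A ++ B := by
  rw [List.pair_infix_append_iff] at h ⊢
  rcases h with h | h | ⟨-, B', h⟩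
  · exact Or.inl h
  · rw [← List.singleton_append (l := B), List.pair_infix_append_iff] at h
    rcases h with h | h | ⟨⟨A', h⟩, -⟩
    · have := h.length_le
      simp at this
    · exact Or.inr (Or.inl h)
    · rcases A' with _ | ⟨_, _⟩
      · simp at h; exact absurd h.symm hx
      · simp at h
  · rw [List.cons.injEq] at h
    exact absurd h.1.symm hy

/-- The component of an edge is a nontrivial finite tree, so it has a leaf, and all neighbours of
the leaf lie in the component. -/
theorem SimpleGraph.IsAcyclic.exists_existsUnique_adj {V : Type*} [Finite V] {G : SimpleGraph V}
    (hG : G.IsAcyclic) {u v : V} (huv : G.Adj u v) : ∃ a, ∃! b, G.Adj a b := by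
  classical
  have := Fintype.ofFinite V
  set c := G.connectedComponentMk u
  have htree : c.toSimpleGraph.IsTree := hG.isTree_connectedComponent c
  have hv : v ∈ c.supp := by
    rw [SimpleGraph.ConnectedComponent.mem_supp_iff, SimpleGraph.ConnectedComponent.eq]
    exact huv.symm.reachable
  have hu : u ∈ c.supp := rfl
  have : Nontrivial c := ⟨⟨u, hu⟩, ⟨v, hv⟩, fun h => huv.ne (congrArg Subtype.val h)⟩
  obtain ⟨a, ha⟩ := htree.exists_vert_degree_one_of_nontrivial
  rw [SimpleGraph.degree_eq_one_iff_existsUnique_adj] at ha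
  obtain ⟨b, hb, hb'⟩ := ha
  refine ⟨a, b, hb, fun w hw => ?_⟩
  have hwc : w ∈ c.supp := by
    have ha : a.1 ∈ c.supp := a.2
    rw [SimpleGraph.ConnectedComponent.mem_supp_iff] at ha ⊢
    rw [← ha, SimpleGraph.ConnectedComponent.eq]
    exact SimpleGraph.Adj.reachable hw.symm
  exact congrArg Subtype.val (hb' ⟨w, hwc⟩ hw)

/-- The vertices can be listed so that all the edges of a given linear forest are between
consecutive vertices. -/
theorem IsLinearForest.exists_list {V : Type*} [Fintype V] [DecidableEq V] :
    ∀ (m : ℕ) (F : Finset (Sym2 V)), F.card = m → (∀ e ∈ F, ¬ e.IsDiag) →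
      IsLinearForest (SimpleGraph.fromEdgeSet (F : Set (Sym2 V))) →
      ∃ l : List V, l.Nodup ∧ (∀ v, v ∈ l) ∧
        ∀ x y, s(x, y) ∈ F → [x, y] <:+: l ∨ [y, x] <:+: l := by
  intro m
  induction m with
  | zero =>
    intro F hF _ _
    rw [Finset.card_eq_zero] at hF
    subst hF
    exact ⟨Finset.univ.toList, Finset.nodup_toList _, by simp, by simp⟩
  | succ m ih =>
    intro F hF hd hlin
    have hadj : ∀ x y, (SimpleGraph.fromEdgeSet (F : Set (Sym2 V))).Adj x y ↔ s(x, y) ∈ F := by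
      intro x y
      rw [SimpleGraph.fromEdgeSet_adj]
      refine ⟨fun h => by simpa using h.1, fun h => ⟨by simpa using h, fun he => hd _ h ?_⟩⟩
      simpa using he
    -- Induction by removing a leaf a with its edge ab: in a list for the remaining forest, a is
    -- taken out and put back next to b.
    obtain ⟨a, b, hab, huniq⟩ : ∃ a, ∃! b, s(a, b) ∈ F := by
      obtain ⟨e, he⟩ := Finset.card_pos.1 (by omega : 0 < F.card)
      induction e with | _ u v
      simpa only [hadj] using hlin.1.exists_existsUnique_adj ((hadj u v).2 he)
    have hne : a ≠ b := fun h => hd _ hab (by simpa using h)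
    have hsub : SimpleGraph.fromEdgeSet ((F.erase s(a, b) : Finset (Sym2 V)) : Set (Sym2 V)) ≤
        SimpleGraph.fromEdgeSet (F : Set (Sym2 V)) :=
      SimpleGraph.fromEdgeSet_mono (by simp)
    obtain ⟨l, hnd, hmem, hl⟩ := ih (F.erase s(a, b)) (by rw [Finset.card_erase_of_mem hab]; omega)
      (fun e he => hd e (Finset.mem_of_mem_erase he))
      ⟨hlin.1.anti hsub, fun v => (Set.encard_le_encard fun w hw => hsub hw).trans (hlin.2 v)⟩
    obtain ⟨P, Q, rfl⟩ := List.append_of_mem (hmem a)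
    have hperm : (a :: (P ++ Q)).Nodup := List.perm_middle.nodup_iff.1 hnd
    have hb : b ∈ P ++ Q := by
      have := hmem b
      simp only [List.mem_append, List.mem_cons] at this ⊢
      tauto
    -- The only forest edge at a is ab, so taking a out of the list separates no other edge.
    have hl' : ∀ x y, s(x, y) ∈ F → s(x, y) ≠ s(a, b) →
        [x, y] <:+: P ++ Q ∨ [y, x] <:+: P ++ Q := by
      intro x y hxy hxy'
      have hx : x ≠ a := by
        rintro rfl
        exact hxy' (by rw [huniq y hxy])
      have hy : y ≠ a := by
        rintro rfl
        rw [Sym2.eq_swap] at hxy hxy'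
        exact hxy' (by rw [huniq x hxy])
      exact (hl x y (Finset.mem_erase.2 ⟨hxy', hxy⟩)).imp
        (List.pair_infix_append_of_insert · hx hy) (List.pair_infix_append_of_insert · hy hx)
    have hmem' : ∀ v, v = a ∨ v ∈ P ++ Q := by
      intro v
      have := hmem v
      simp only [List.mem_append, List.mem_cons] at this ⊢
      tauto
    obtain ⟨A, B, hAB⟩ := List.append_of_mem hb
    rw [hAB] at hperm hl' hmem'
    -- `b` has at most one neighbour in the forest besides `a`
    have hend : (∀ A' x, A = A' ++ [x] → s(x, b) ∉ F) ∨ (∀ B' y, B = y :: B' → s(b, y) ∉ F) := by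
      by_contra! h
      obtain ⟨⟨A', x, rfl, hx⟩, B', y, rfl, hy⟩ := h
      have h3 : ({a, x, y} : Set V) ⊆
          (SimpleGraph.fromEdgeSet (F : Set (Sym2 V))).neighborSet b := by
        rintro w (rfl | rfl | rfl)
        · rw [SimpleGraph.mem_neighborSet, hadj, Sym2.eq_swap]; exact hab
        · rw [SimpleGraph.mem_neighborSet, hadj, Sym2.eq_swap]; exact hx
        · rw [SimpleGraph.mem_neighborSet, hadj]; exact hy
      have := (Set.encard_le_encard h3).trans (hlin.2 b)
      rw [Set.encard_eq_three.2 ⟨a, x, y, ?_, ?_, ?_, rfl⟩] at this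
      · norm_num at this
      · rintro rfl; simp at hperm
      · rintro rfl; simp at hperm
      · rintro rfl; simp [List.nodup_append] at hperm
    rcases hend with hA | hB
    · refine ⟨A ++ a :: b :: B, ?_, ?_, ?_⟩
      · exact List.perm_middle.nodup_iff.2 hperm
      · intro v
        have := hmem' v
        simp only [List.mem_append, List.mem_cons] at this ⊢
        tauto
      · have aux : ∀ x y, s(x, y) ∈ F → [x, y] <:+: A ++ b :: B →
            [x, y] <:+: A ++ a :: b :: B := by
          intro x y hxy h
          rw [List.pair_infix_append_iff] at h ⊢
          rcases h with h | h | ⟨⟨A', rfl⟩, B', h⟩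
          · exact Or.inl h
          · exact Or.inr (Or.inl (h.trans (List.suffix_cons _ _).isInfix))
          · rw [List.cons.injEq] at h
            exact absurd (h.1 ▸ hxy) (hA A' x rfl)
        intro x y hxy
        by_cases he : s(x, y) = s(a, b)
        · rcases Sym2.eq_iff.1 he with ⟨rfl, rfl⟩ | ⟨rfl, rfl⟩
          · exact Or.inl ⟨A, B, by simp⟩
          · exact Or.inr ⟨A, B, by simp⟩
        · exact (hl' x y hxy he).imp (aux x y hxy) (aux y x (by rwa [Sym2.eq_swap]))
    · refine ⟨A ++ b :: a :: B, ?_, ?_, ?_⟩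
      · have := (List.perm_middle (l₁ := A ++ [b]) (l₂ := B) (a := a)).nodup_iff.2
          (by simpa using hperm)
        simpa using this
      · intro v
        have := hmem' v
        simp only [List.mem_append, List.mem_cons] at this ⊢
        tauto
      · have aux : ∀ x y, s(x, y) ∈ F → [x, y] <:+: A ++ b :: B →
            [x, y] <:+: A ++ b :: a :: B := by
          intro x y hxy h
          have e1 : A ++ b :: B = (A ++ [b]) ++ B := by simp
          have e2 : A ++ b :: a :: B = (A ++ [b]) ++ a :: B := by simp
          rw [e1, List.pair_infix_append_iff] at h
          rw [e2, List.pair_infix_append_iff]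
          rcases h with h | h | ⟨⟨A', h⟩, B', rfl⟩
          · exact Or.inl h
          · exact Or.inr (Or.inl (h.trans (List.suffix_cons _ _).isInfix))
          · have := (List.append_inj' h rfl).2
            rw [List.cons.injEq] at this
            exact absurd (this.1 ▸ hxy) (hB B' y rfl)
        intro x y hxy
        by_cases he : s(x, y) = s(a, b)
        · rcases Sym2.eq_iff.1 he with ⟨rfl, rfl⟩ | ⟨rfl, rfl⟩
          · exact Or.inr ⟨A, B, by simp⟩
          · exact Or.inl ⟨A, B, by simp⟩
        · exact (hl' x y hxy he).imp (aux x y hxy) (aux y x (by rwa [Sym2.eq_swap]))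

theorem IsLinearForest.hasHamCycle_top {V : Type*} [Fintype V] {F : Finset (Sym2 V)}
    (hn : 2 ≤ Fintype.card V) (hd : ∀ e ∈ F, ¬ e.IsDiag)
    (hlin : IsLinearForest (SimpleGraph.fromEdgeSet (F : Set (Sym2 V)))) :
    HasHamCycle (⊤ : SimpleGraph V) F := by
  classical
  obtain ⟨l, hnd, hmem, hl⟩ := IsLinearForest.exists_list _ F rfl hd hlin
  have hlen : l.length = Fintype.card V := by
    rw [← List.toFinset_card_of_nodup hnd, ← Finset.card_univ]
    congr 1
    ext v
    simp [hmem v]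
  have : Nonempty V := Fintype.card_pos_iff.1 (by omega)
  obtain ⟨v₀⟩ := this
  have hinj : ∀ i < Fintype.card V, ∀ j < Fintype.card V,
      l.getD i v₀ = l.getD j v₀ → i = j := by
    intro i hi j hj h
    rw [List.getD_eq_getElem _ _ (by omega), List.getD_eq_getElem _ _ (by omega)] at h
    exact (hnd.getElem_inj_iff).1 h
  refine ⟨fun i => l.getD i v₀, ⟨hinj, ?_, ?_, ?_⟩, ?_⟩
  · intro v
    obtain ⟨i, hi, rfl⟩ := List.getElem_of_mem (hmem v)
    exact ⟨i, by omega, List.getD_eq_getElem _ _ hi⟩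
  · intro i hi
    rw [SimpleGraph.top_adj]
    intro h
    have := hinj _ (by omega) _ (by omega) h
    omega
  · have aux : ∀ x y, [x, y] <:+: l → ∃ i, i + 1 < Fintype.card V ∧
        x = l.getD i v₀ ∧ y = l.getD (i + 1) v₀ := by
      rintro x y ⟨s, t, rfl⟩
      refine ⟨s.length, ?_, ?_, ?_⟩
      · rw [← hlen]; simp
      · simp
      · simp
    intro e he
    induction e with | _ x y
    rcases hl x y he with h | h
    · obtain ⟨i, hi, hx, hy⟩ := aux _ _ h
      exact ⟨i, hi, by rw [hx, hy]⟩
    · obtain ⟨i, hi, hx, hy⟩ := aux _ _ h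
      exact ⟨i, hi, by rw [hx, hy, Sym2.eq_swap]⟩
  · rw [SimpleGraph.top_adj]
    intro h
    have := hinj _ (by omega) _ (by omega) h
    omega

/-! ### Eigenvector estimates -/

section Eigenvector

variable {V : Type*} [Fintype V] {G : SimpleGraph V} [DecidableRel G.Adj] {l : ℝ} {x : V → ℝ}

/-- At a vertex with the largest entry M, the neighbours sum to l M and the vertex itself adds
another M. -/
theorem exists_max_of_eigenvector (hx : ∀ v, 0 ≤ x v) (hx0 : x ≠ 0)
    (h : ∀ v, ∑ w ∈ G.neighborFinset v, x w = l * x v) :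
    ∃ M, 0 < M ∧ (∀ v, x v ≤ M) ∧ (l + 1) * M ≤ ∑ v, x v := by
  classical
  obtain ⟨v₀, hv₀⟩ := Function.ne_iff.1 hx0
  have : Nonempty V := ⟨v₀⟩
  obtain ⟨w, hw⟩ := Finite.exists_max x
  refine ⟨x w, ((hx v₀).lt_of_ne' hv₀).trans_le (hw v₀), hw, ?_⟩
  have hnot : w ∉ G.neighborFinset w := by simp
  rw [add_mul, one_mul, ← h w, add_comm, ← Finset.sum_insert hnot]
  exact Finset.sum_le_sum_of_subset_of_nonneg (Finset.subset_univ _) fun v _ _ => hx v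

theorem eigenvector_le_of_degree_le {M : ℝ} {D : ℕ} (hM : 0 ≤ M) (hxM : ∀ v, x v ≤ M)
    (h : ∀ v, ∑ w ∈ G.neighborFinset v, x w = l * x v) {u : V} (hu : G.degree u ≤ D) :
    l * x u ≤ D * M := by
  rw [← h u]
  refine (Finset.sum_le_card_nsmul _ _ M fun w _ => hxM w).trans ?_
  rw [SimpleGraph.card_neighborFinset_eq_degree, nsmul_eq_mul]
  gcongr

/-- When l is large compared with |T| D, the whole set T weighs only a small fraction of M. -/
theorem mul_sum_eigenvector_le {M : ℝ} {D : ℕ} (hM : 0 ≤ M) (hxM : ∀ v, x v ≤ M)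
    (h : ∀ v, ∑ w ∈ G.neighborFinset v, x w = l * x v) {T : Finset V}
    (hT : ∀ u ∈ T, G.degree u ≤ D) :
    l * ∑ u ∈ T, x u ≤ T.card * D * M := by
  rw [Finset.mul_sum, mul_assoc, ← nsmul_eq_mul]
  exact Finset.sum_le_card_nsmul _ _ _ fun u hu => eigenvector_le_of_degree_le hM hxM h (hT u hu)

/-- An eigenvalue forces the number of vertices of small degree to be small. -/
theorem card_low_degree_le (hx : ∀ v, 0 ≤ x v) (hx0 : x ≠ 0)
    (h : ∀ v, ∑ w ∈ G.neighborFinset v, x w = l * x v) {T : Finset V} {D c : ℕ}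
    (hT : ∀ u ∈ T, G.degree u ≤ D) (hl : (T.card : ℝ) * D < l)
    (hlc : (Fintype.card V : ℝ) - c - 1 ≤ l) : T.card ≤ c := by
  classical
  by_contra! hc
  obtain ⟨M, hM, hxM, hsum⟩ := exists_max_of_eigenvector hx hx0 h
  have hl0 : 0 < l := lt_of_le_of_lt (by positivity) hl
  have h1 := mul_sum_eigenvector_le hM.le hxM h hT
  have h2 : ∑ v ∈ Tᶜ, x v ≤ (Fintype.card V - T.card : ℝ) * M := by
    refine (Finset.sum_le_card_nsmul _ _ M fun w _ => hxM w).trans ?_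
    rw [nsmul_eq_mul, Finset.card_compl, Nat.cast_sub (Finset.card_le_univ T)]
  have h3 : (c : ℝ) + 1 ≤ T.card := by exact_mod_cast hc
  rw [← Finset.sum_add_sum_compl T] at hsum
  have h4 : ∑ u ∈ T, x u < M := by
    by_contra! h4
    have : l * M ≤ T.card * D * M := (mul_le_mul_of_nonneg_left h4 hl0.le).trans h1
    have := le_of_mul_le_mul_right this hM
    linarith
  have h5 : (Fintype.card V - T.card : ℝ) * M ≤ l * M := by gcongr; linarith
  linarith

/-- If the eigenvalue is at least that of a clique on the complement of a small set `T` of vertices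
of small degree, then this complement is a clique. -/
theorem adj_of_eigenvector (hx : ∀ v, 0 ≤ x v) (hx0 : x ≠ 0)
    (h : ∀ v, ∑ w ∈ G.neighborFinset v, x w = l * x v) {T : Finset V} {D : ℕ}
    (hT : ∀ u ∈ T, G.degree u ≤ D) (hl : (2 * D + 1 : ℝ) * (T.card * D) < l)
    (hlT : (Fintype.card V : ℝ) - T.card - 1 ≤ l) {p q : V} (hp : p ∉ T) (hq : q ∉ T)
    (hpq : p ≠ q) : G.Adj p q := by
  classical
  by_contra hadj
  obtain ⟨M, hM, hxM, hsum⟩ := exists_max_of_eigenvector hx hx0 h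
  have hl0 : 0 < l := lt_of_le_of_lt (by positivity) hl
  have h1 := mul_sum_eigenvector_le hM.le hxM h hT
  rw [← Finset.sum_add_sum_compl T] at hsum
  set X := ∑ u ∈ T, x u with hX
  set S := ∑ u ∈ Tᶜ, x u with hS
  have hX0 : 0 ≤ X := Finset.sum_nonneg fun v _ => hx v
  have hS0 : 0 ≤ S := Finset.sum_nonneg fun v _ => hx v
  -- d p is the weight of the non-neighbours of p outside T, and t p that of its neighbours in T.
  set d : V → ℝ := fun p => ∑ q ∈ Tᶜ.filter (fun q => q ≠ p ∧ ¬ G.Adj p q), x q with hd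
  set t : V → ℝ := fun p => ∑ u ∈ T.filter (fun u => G.Adj p u), x u with ht
  have hd0 : ∀ p, 0 ≤ d p := fun p => Finset.sum_nonneg fun v _ => hx v
  have ht0 : ∀ p, 0 ≤ t p := fun p => Finset.sum_nonneg fun v _ => hx v
  -- the eigenvalue equation, with the missing edges explicit
  have heq : ∀ p ∈ Tᶜ, l * x p = S - x p - d p + t p := by
    intro p hp
    have e1 : ∑ w ∈ G.neighborFinset p, x w =
        ∑ w ∈ T.filter (fun u => G.Adj p u), x w + ∑ w ∈ Tᶜ.filter (fun u => G.Adj p u), x w := by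
      rw [Finset.sum_filter, Finset.sum_filter, Finset.sum_add_sum_compl,
        SimpleGraph.neighborFinset_eq_filter, Finset.sum_filter]
    have e2 : S = x p + d p + ∑ w ∈ Tᶜ.filter (fun u => G.Adj p u), x w := by
      rw [hS, ← Finset.sum_filter_add_sum_filter_not Tᶜ (fun u => G.Adj p u), add_comm]
      congr 1
      have : Tᶜ.filter (fun u => ¬ G.Adj p u) =
          insert p (Tᶜ.filter fun q => q ≠ p ∧ ¬ G.Adj p q) := by
        ext q
        simp only [Finset.mem_filter, Finset.mem_insert]
        by_cases hqp : q = p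
        · subst hqp; simp_all
        · simp [hqp]
      rw [this, Finset.sum_insert (by simp)]
    rw [← h p, e1]
    linarith
  have hm : (Tᶜ.card : ℝ) = Fintype.card V - T.card := by
    rw [Finset.card_compl, Nat.cast_sub (Finset.card_le_univ T)]
  have hsumeq : l * S = Tᶜ.card * S - S - ∑ p ∈ Tᶜ, d p + ∑ p ∈ Tᶜ, t p := by
    rw [hS, Finset.mul_sum, Finset.sum_congr rfl heq, Finset.sum_add_distrib,
      Finset.sum_sub_distrib, Finset.sum_sub_distrib, Finset.sum_const, nsmul_eq_mul]
  have htsum : ∑ p ∈ Tᶜ, t p ≤ D * X := by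
    calc ∑ p ∈ Tᶜ, t p = ∑ u ∈ T, ∑ p ∈ Tᶜ.filter (fun p => G.Adj p u), x u := by
          simp only [ht, Finset.sum_filter]
          exact Finset.sum_comm
      _ ≤ ∑ u ∈ T, D * x u := by
          refine Finset.sum_le_sum fun u hu => ?_
          rw [Finset.sum_const, nsmul_eq_mul]
          refine mul_le_mul_of_nonneg_right ?_ (hx u)
          have : (Tᶜ.filter fun p => G.Adj p u).card ≤ G.degree u := by
            rw [← SimpleGraph.card_neighborFinset_eq_degree]
            refine Finset.card_le_card fun p hp => ?_
            rw [SimpleGraph.mem_neighborFinset]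
            exact (Finset.mem_filter.1 hp).2.symm
          exact_mod_cast this.trans (hT u hu)
      _ = D * X := by rw [hX, Finset.mul_sum]
  -- Summed over the complement of T, the equations say that l exceeds the clique value |Tᶜ| - 1
  -- only through T; as l is at least that value, the missing edges cost no more than T contributes.
  have hdsum : ∑ p ∈ Tᶜ, d p ≤ D * X := by
    have : (Tᶜ.card - 1 - l) * S ≤ 0 := mul_nonpos_of_nonpos_of_nonneg (by linarith) hS0
    linarith
  have hd1 : ∀ p, p ∉ T → d p ≤ D * X := fun p hp =>
    (Finset.single_le_sum (f := d) (fun v _ => hd0 v) (Finset.mem_compl.2 hp)).trans hdsum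
  -- A missing edge pq makes p a term of d q. So x p is small, and the equation at p then bounds S,
  -- hence M, in terms of X.
  have hxp : x p ≤ D * X := by
    refine le_trans ?_ (hd1 q hq)
    refine Finset.single_le_sum (f := x) (fun v _ => hx v) ?_
    rw [Finset.mem_filter, Finset.mem_compl]
    exact ⟨hp, hpq, fun h => hadj h.symm⟩
  have hp1 := heq p (Finset.mem_compl.2 hp)
  have hp2 := hd1 p hp
  have hp3 := ht0 p
  have h6 : (l + 1) * M ≤ (D + 1) * X + (l + 1) * (D * X) := by
    have : (l + 1) * x p ≤ (l + 1) * (D * X) := by gcongr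
    linarith
  have h7 : (l + 1) * M ≤ (l + 1) * ((2 * D + 1) * X) := by
    have : 0 ≤ l * X * (D + 1) := by positivity
    linarith
  have h8 : M ≤ (2 * D + 1) * X := le_of_mul_le_mul_left h7 (by linarith)
  have h9 : l * M ≤ (2 * D + 1) * (T.card * D) * M := by
    calc l * M ≤ l * ((2 * D + 1) * X) := by gcongr
      _ = (2 * D + 1) * (l * X) := by ring
      _ ≤ (2 * D + 1) * (T.card * D * M) := by gcongr
      _ = _ := by ring
  have := le_of_mul_le_mul_right h9 hM
  linarith

end Eigenvector

/-! ### From degree sums to a large clique -/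

/-- A graph with almost all edges, in which nonadjacent vertices have small degree sum, is a clique
up to a bounded number of vertices of bounded degree. -/
theorem isClique_high_degree {V : Type*} [Fintype V] [DecidableEq V] (G : SimpleGraph V)
    [DecidableRel G.Adj] {k c : ℕ} (hn : 3 * (4 * (2 * c + 1)) + 2 * k + 2 ≤ Fintype.card V)
    (hdeg : ∀ u v, u ≠ v → ¬ G.Adj u v → G.degree u + G.degree v ≤ Fintype.card V - 1 + k)
    (hsum : (Fintype.card V - c - 1) ^ 2 ≤ ∑ v, G.degree v) :
    (Finset.univ.filter fun v => G.degree v ≤ k + 4 * (2 * c + 1)).card ≤ 4 * (2 * c + 1) ∧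
    ∀ u v, u ≠ v → k + 4 * (2 * c + 1) < G.degree u → k + 4 * (2 * c + 1) < G.degree v →
      G.Adj u v := by
  set n := Fintype.card V with hnV
  set b := 4 * (2 * c + 1) with hb
  set W := Finset.univ.filter fun v => 2 * G.degree v ≤ n - 1 + k with hW
  have hlt : ∀ v, G.degree v ≤ n - 1 := fun v => by
    have := G.degree_lt_card_verts v
    omega
  have hco : ∑ v, (n - 1 - G.degree v) + ∑ v, G.degree v = n * (n - 1) := by
    rw [← Finset.sum_add_distrib, Finset.sum_congr rfl fun v _ => Nat.sub_add_cancel (hlt v)]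
    simp [hnV]
  -- With n = m + c + 1, the degree deficit is at most n(n - 1) - m² = (2c + 1) m + c(c + 1).
  have hco' : ∑ v, (n - 1 - G.degree v) ≤ (2 * c + 1) * n := by
    obtain ⟨m, hm⟩ : ∃ m, n = m + c + 1 := ⟨n - c - 1, by omega⟩
    rw [hm] at hco hsum ⊢
    rw [show m + c + 1 - c - 1 = m by omega] at hsum
    rw [show m + c + 1 - 1 = m + c by omega] at hco ⊢
    nlinarith
  have hWsum : W.card * (n - 1 - k) ≤ 2 * ∑ v, (n - 1 - G.degree v) := by
    rw [Finset.mul_sum, ← smul_eq_mul]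
    refine (Finset.card_nsmul_le_sum W _ _ fun v hv => ?_).trans
      (Finset.sum_le_sum_of_subset (Finset.subset_univ W))
    have := (Finset.mem_filter.1 hv).2
    omega
  -- Each vertex of W misses at least (n - 1 - k)/2 others, and n ≤ 2(n - 1 - k); this is where b =
  -- 4(2c + 1) comes from.
  have hWcard : W.card ≤ b := by
    have h1 : W.card * (n - 1 - k) ≤ b * (n - 1 - k) := by
      obtain ⟨m, hm⟩ : ∃ m, n - 1 - k = m := ⟨_, rfl⟩
      have h2 : n ≤ 2 * m := by omega
      rw [hm] at hWsum ⊢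
      have : (2 * c + 1) * n ≤ (2 * c + 1) * (2 * m) := Nat.mul_le_mul_left _ h2
      rw [hb]
      linarith
    exact Nat.le_of_mul_le_mul_right h1 (by omega)
  have hlight : ∀ u v, u ≠ v → u ∉ W → v ∉ W → G.Adj u v := by
    intro u v huv hu hv
    by_contra h
    have := hdeg u v huv h
    simp only [hW, Finset.mem_filter, Finset.mem_univ, true_and, not_le] at hu hv
    omega
  have hjoin : ∀ v, (∀ u, u ∉ W → u ≠ v → G.Adj v u) → n - b - 1 ≤ G.degree v := by
    intro v hv
    rw [← SimpleGraph.card_neighborFinset_eq_degree]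
    have hsub : Wᶜ.erase v ⊆ G.neighborFinset v := by
      intro u hu
      rw [Finset.mem_erase, Finset.mem_compl] at hu
      rw [SimpleGraph.mem_neighborFinset]
      exact hv u hu.2 hu.1
    refine le_trans ?_ (Finset.card_le_card hsub)
    have h1 := Finset.pred_card_le_card_erase (s := Wᶜ) (a := v)
    rw [Finset.card_compl] at h1
    omega
  have hlightdeg : ∀ v, v ∉ W → n - b - 1 ≤ G.degree v := fun v hv =>
    hjoin v fun u hu huv => hlight v u huv.symm hv hu
  -- Degrees have a gap: above k + b, the degree-sum condition forces adjacency to all other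
  -- vertices outside W, so the degree is at least n - b - 1.
  have hhigh : ∀ v, k + b < G.degree v → n - b - 1 ≤ G.degree v := by
    intro v hv
    refine hjoin v fun u hu huv => ?_
    by_contra h
    have := hdeg v u huv.symm h
    have := hlightdeg u hu
    omega
  refine ⟨(Finset.card_le_card fun v hv => ?_).trans hWcard, fun u v huv hu hv => ?_⟩
  · by_contra hvW
    have := hlightdeg v hvW
    have := (Finset.mem_filter.1 hv).2
    omega
  · by_contra h
    have := hdeg u v huv h
    have := hhigh u hu
    have := hhigh v hv
    omega

/-! ### The small set T and its neighbourhood -/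

section Structure

variable {V : Type*} [Fintype V] [DecidableEq V] {G : SimpleGraph V} [DecidableRel G.Adj]
  {F : Finset (Sym2 V)} {T : Finset V} {k : ℕ}

/-- If all Hamilton paths through `F` from `T` to `v` are tight for the crossing argument, then
`T` has a vertex that is adjacent to all the others, or one that is adjacent to none. -/
theorem exists_full_or_isolated (hno : ¬ HasHamCycle G F) (hF : F.card ≤ k) {v : V} (hv : v ∉ T)
    (hclique : ∀ w, w ∉ T → w ≠ v → G.Adj w v) (hvT : ∀ w ∈ T, ¬ G.Adj w v)
    (htight : ∀ u ∈ T, Fintype.card V - 1 + k ≤ G.degree u + G.degree v)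
    {p : ℕ → V} (hp : IsHamPath G F p) (hp0 : p 0 ∈ T) (hpv : p (Fintype.card V - 1) = v) :
    ∃ u ∈ T, (∀ w ∈ T, w ≠ u → G.Adj u w) ∨ ∀ w ∈ T, ¬ G.Adj u w := by
  set n := Fintype.card V with hn
  -- The class of paths to be rotated. The end v stays fixed, and every vertex of T can become the
  -- start, so tightness is available after each rotation.
  let Good : (ℕ → V) → Prop := fun q => IsHamPath G F q ∧ q 0 ∈ T ∧ q (n - 1) = v
  have hT : ∀ q, Good q → ∀ i, i + 1 < n → q i ∈ T → G.Adj (q 0) (q (i + 1)) := by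
    rintro q ⟨hq, h0, hl⟩ i hi hqi
    have := ((hq.degree_add_degree hno hF).2 (by rw [← hn, hl]; exact htight _ h0)).1 i hi
    rw [← hn, hl] at this
    exact this.resolve_right (hvT _ hqi)
  have hFT : ∀ q, Good q → ∀ i, i + 1 < n → s(q i, q (i + 1)) ∈ F → q i ∉ T := by
    rintro q ⟨hq, h0, hl⟩ i hi hqi hiT
    have := (((hq.degree_add_degree hno hF).2 (by rw [← hn, hl]; exact htight _ h0)).2 i hi hqi).2
    rw [← hn, hl] at this
    exact hvT _ hiT this
  have hnF : ∀ q, Good q → ∀ i, i + 1 < n → q i ∉ T → G.Adj (q 0) (q (i + 1)) →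
      s(q i, q (i + 1)) ∈ F := by
    rintro q ⟨hq, h0, hl⟩ i hi hiT hadj
    refine hq.mem_of_crossing hno hi hadj ?_
    rw [← hn, hl]
    refine hclique _ hiT fun h => ?_
    rw [← hl] at h
    have := hq.inj _ (by omega) _ (by omega) h
    omega
  have hend : ∀ q, Good q → ∀ i < n, q i ∈ T → i + 1 < n := by
    rintro q ⟨hq, h0, hl⟩ i hi hiT
    by_contra h
    obtain rfl : i = n - 1 := by omega
    exact hv (hl ▸ hiT)
  have hrot : ∀ q, Good q → ∀ j < n, q j ∈ T → Good (reversePrefix q j) := by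
    intro q hq j hj hjT
    have hj' := hend q hq j hj hjT
    refine ⟨hq.1.reversePrefix hj' (hT q hq j hj' hjT) fun h => hFT q hq j hj' h hjT, ?_, ?_⟩
    · rw [reversePrefix_zero]; exact hjT
    · rw [reversePrefix_of_lt _ _ (by omega)]; exact hq.2.2
  -- Rotating so that q (i + 1) becomes the start turns this pair into the first one, now read from
  -- T. Thus no edge of F touches T.
  have hFT' : ∀ q, Good q → ∀ i, i + 1 < n → s(q i, q (i + 1)) ∈ F → q (i + 1) ∉ T := by
    intro q hq i hi hqF hiT
    refine hFT _ (hrot q hq (i + 1) hi hiT) 0 (by omega) ?_ ?_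
    · rw [reversePrefix_zero, reversePrefix_of_le _ _ (by omega), Sym2.eq_swap]
      exact hqF
    · rw [reversePrefix_zero]; exact hiT
  have hgood : Good p := ⟨hp, hp0, hpv⟩
  -- The start is adjacent to every successor of a vertex of T, and to no vertex of T whose
  -- predecessor is outside T. If T has no two consecutive vertices, the start is isolated in T.
  by_cases hcons : ∃ i, i + 1 < n ∧ p i ∈ T ∧ p (i + 1) ∈ T
  · obtain ⟨i, hi, hiT, hiT'⟩ := hcons
    obtain ⟨q, hq, hq1⟩ : ∃ q, Good q ∧ q 1 ∈ T :=
      ⟨_, hrot p hgood (i + 1) hi hiT', by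
        rw [reversePrefix_of_le _ _ (by omega)]; exact hiT⟩
    -- `T` is an initial segment of `q`
    have hinit : ∀ i, i + 1 < n → q (i + 1) ∈ T → q i ∈ T := by
      intro i hi hiT
      by_contra hiK
      have hi0 : i ≠ 0 := by rintro rfl; exact hiK hq.2.1
      have h1 : ¬ G.Adj (q 0) (q (i + 1)) := fun h =>
        hFT' q hq i hi (hnF q hq i hi hiK h) hiT
      have h2 := hT _ (hrot q hq (i + 1) hi hiT) i hi
      rw [reversePrefix_zero, reversePrefix_of_le _ _ (by omega),
        reversePrefix_of_le _ _ (by omega), Nat.sub_self,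
        show i + 1 - i = 1 by omega] at h2
      exact h1 (h2 hq1).symm
    refine ⟨q 0, hq.2.1, Or.inl fun w hw hne => ?_⟩
    obtain ⟨i, hi, rfl⟩ := hq.1.surj w
    obtain ⟨i, rfl⟩ : ∃ j, i = j + 1 := ⟨i - 1, by
      have : i ≠ 0 := by rintro rfl; exact hne rfl
      omega⟩
    exact hT q hq i hi (hinit i hi hw)
  · push Not at hcons
    refine ⟨p 0, hp0, Or.inr fun w hw hadj => ?_⟩
    obtain ⟨i, hi, rfl⟩ := hp.surj w
    obtain ⟨i, rfl⟩ : ∃ j, i = j + 1 := ⟨i - 1, by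
      have : i ≠ 0 := by rintro rfl; exact hadj.ne rfl
      omega⟩
    exact hFT' p hgood i hi (hnF p hgood i hi (fun h => hcons i hi h hw) hadj) hw

theorem degree_eq_of_clique (hclique : ∀ u v, u ∉ T → v ∉ T → u ≠ v → G.Adj u v) {v : V}
    (hv : v ∉ T) :
    G.degree v = Fintype.card V - T.card - 1 + (T.filter fun u => G.Adj u v).card := by
  rw [← SimpleGraph.card_neighborFinset_eq_degree, ← Finset.card_compl,
    ← Finset.card_erase_of_mem (Finset.mem_compl.2 hv), ← Finset.card_union_of_disjoint]
  · congr 1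
    ext w
    simp only [SimpleGraph.mem_neighborFinset, Finset.mem_union, Finset.mem_erase,
      Finset.mem_compl, Finset.mem_filter]
    by_cases hw : w ∈ T
    · simp [hw, SimpleGraph.adj_comm]
    · simp only [hw, not_false_eq_true, and_true, false_and, or_false]
      exact ⟨fun h => h.ne', fun h => hclique v w hv hw h.symm⟩
  · rw [Finset.disjoint_left]
    intro w hw hw'
    exact (Finset.mem_compl.1 (Finset.mem_of_mem_erase hw)) (Finset.mem_filter.1 hw').1

/-- The structure of the edge-maximal graphs without a Hamilton cycle through `F` that are cliques
up to few vertices of small degree. -/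
theorem exists_structure_of_maximal {δ : ℕ} (hn : 3 ≤ Fintype.card V)
    (hFG : (F : Set (Sym2 V)) ⊆ G.edgeSet) (hmax : Maximal (fun H => ¬ HasHamCycle H F) G)
    (hF : F.card ≤ k) (hδ : ∀ v, δ ≤ G.degree v)
    (hclique : ∀ u v, u ∉ T → v ∉ T → u ≠ v → G.Adj u v) (hT0 : T.Nonempty)
    (hTcard : T.card + k ≤ δ) (hTdeg : ∀ u ∈ T, G.degree u + T.card < Fintype.card V) :
    T.card + k = δ ∧ (∀ u ∈ T, G.degree u = δ) ∧ ∃ N : Finset V, Disjoint N T ∧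
      (∀ v ∉ T, ∀ u ∈ T, G.Adj u v ↔ v ∈ N) ∧
      ((N.card = δ ∧ ∀ u ∈ T, ∀ w ∈ T, ¬ G.Adj u w) ∨
        (N.card = k + 1 ∧ ∀ u ∈ T, ∀ w ∈ T, u ≠ w → G.Adj u w)) := by
  have hTn : T.card < Fintype.card V := by
    obtain ⟨u, hu⟩ := hT0
    have := hTdeg u hu
    omega
  have hnon : ∀ u ∈ T, ∃ v ∉ T, ¬ G.Adj u v := by
    intro u hu
    by_contra! h
    have hsub : Tᶜ ⊆ G.neighborFinset u := fun v hv => by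
      rw [SimpleGraph.mem_neighborFinset]
      exact h v (Finset.mem_compl.1 hv)
    have h1 := Finset.card_le_card hsub
    rw [Finset.card_compl, SimpleGraph.card_neighborFinset_eq_degree] at h1
    have := hTdeg u hu
    omega
  have hpath : ∀ u ∈ T, ∀ v ∉ T, ¬ G.Adj u v →
      ∃ p, IsHamPath G F p ∧ p 0 = u ∧ p (Fintype.card V - 1) = v := fun u hu v hv h =>
    exists_isHamPath_of_maximal hn hFG hmax (fun h => hv (h ▸ hu)) h
  -- δ + (n - |T| - 1) ≤ deg u + deg v ≤ n - 1 + k together with |T| + k ≤ δ leaves no slack, not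
  -- even one neighbour of v in T.
  have hkey : ∀ u ∈ T, ∀ v ∉ T, ¬ G.Adj u v →
      T.card + k = δ ∧ G.degree u = δ ∧ ∀ w ∈ T, ¬ G.Adj w v := by
    intro u hu v hv huv
    obtain ⟨p, hp, rfl, rfl⟩ := hpath u hu v hv huv
    have h1 := (hp.degree_add_degree hmax.prop hF).1
    have h2 := degree_eq_of_clique hclique hv
    have h3 := hδ (p 0)
    refine ⟨by omega, by omega, ?_⟩
    rw [← Finset.filter_eq_empty_iff, ← Finset.card_eq_zero]
    omega
  have hcard : T.card + k = δ := by
    obtain ⟨u, hu⟩ := hT0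
    obtain ⟨v, hv, huv⟩ := hnon u hu
    exact (hkey u hu v hv huv).1
  have hdeg : ∀ u ∈ T, G.degree u = δ := by
    intro u hu
    obtain ⟨v, hv, huv⟩ := hnon u hu
    exact (hkey u hu v hv huv).2.1
  obtain ⟨N, hN⟩ : ∃ N, N = Tᶜ.filter fun v => ∀ u ∈ T, G.Adj u v := ⟨_, rfl⟩
  have hNadj : ∀ v ∉ T, ∀ u ∈ T, G.Adj u v ↔ v ∈ N := by
    intro v hv u hu
    rw [hN, Finset.mem_filter, Finset.mem_compl]
    refine ⟨fun h => ⟨hv, fun w hw => ?_⟩, fun h => h.2 u hu⟩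
    by_contra hwv
    exact (hkey w hw v hv hwv).2.2 u hu h
  have hdisj : Disjoint N T := by
    rw [Finset.disjoint_left]
    exact fun v hv => Finset.mem_compl.1 (Finset.mem_filter.1 (hN ▸ hv)).1
  -- All vertices of T have the same number of neighbours in T, so one full or isolated vertex
  -- decides whether T is complete or empty.
  have hsplit : ∀ u ∈ T, N.card + (T.filter fun w => G.Adj u w).card = δ := by
    intro u hu
    rw [← hdeg u hu, ← SimpleGraph.card_neighborFinset_eq_degree,
      ← Finset.card_union_of_disjoint (hdisj.mono_right (Finset.filter_subset _ _))]
    congr 1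
    ext w
    rw [Finset.mem_union, Finset.mem_filter, SimpleGraph.mem_neighborFinset]
    by_cases hw : w ∈ T
    · have : w ∉ N := fun h => (Finset.disjoint_left.1 hdisj h) hw
      tauto
    · rw [← hNadj w hw u hu]
      simp [hw]
  have herase : ∀ u ∈ T, (T.filter fun w => G.Adj u w) ⊆ T.erase u := by
    intro u hu w hw
    rw [Finset.mem_filter] at hw
    exact Finset.mem_erase.2 ⟨hw.2.ne', hw.1⟩
  refine ⟨hcard, hdeg, N, hdisj, hNadj, ?_⟩
  obtain ⟨u, hu⟩ := hT0
  obtain ⟨v, hv, huv⟩ := hnon u hu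
  obtain ⟨p, hp, hp0, hpv⟩ := hpath u hu v hv huv
  have hvT := (hkey u hu v hv huv).2.2
  have hvdeg := degree_eq_of_clique hclique hv
  obtain ⟨a, ha, hfull | hiso⟩ := exists_full_or_isolated hmax.prop hF hv
    (fun w hw hne => hclique w v hw hv hne) hvT
    (fun w hw => by rw [hdeg w hw]; omega) hp (hp0 ▸ hu) hpv
  · right
    have h1 : (T.filter fun w => G.Adj a w) = T.erase a := by
      refine (herase a ha).antisymm fun w hw => ?_
      rw [Finset.mem_erase] at hw
      exact Finset.mem_filter.2 ⟨hw.2, hfull w hw.2 hw.1⟩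
    have h2 := hsplit a ha
    rw [h1, Finset.card_erase_of_mem ha] at h2
    have h3 : 0 < T.card := Finset.card_pos.2 ⟨a, ha⟩
    refine ⟨by omega, fun b hb w hw hne => ?_⟩
    have h4 := Finset.eq_of_subset_of_card_le (herase b hb) (by
      have := hsplit b hb
      rw [Finset.card_erase_of_mem hb]; omega)
    have : w ∈ T.filter fun w => G.Adj b w := h4 ▸ Finset.mem_erase.2 ⟨hne.symm, hw⟩
    exact (Finset.mem_filter.1 this).2
  · left
    have h2 := hsplit a ha
    rw [Finset.filter_eq_empty_iff.2 fun {w} hw => hiso w hw, Finset.card_empty] at h2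
    refine ⟨by omega, fun b hb => ?_⟩
    have h3 := hsplit b hb
    have h4 : (T.filter fun w => G.Adj b w).card = 0 := by omega
    exact fun w hw => Finset.filter_eq_empty_iff.1 (Finset.card_eq_zero.1 h4) hw

end Structure

/-! ### Recognition of the extremal graphs and the theorem -/

/-- A graph is the join of a clique with the union of a clique and a complete or empty graph as
soon as its adjacency relation looks like it. -/
theorem nonempty_iso_graphJoin {V : Type*} [Fintype V] [DecidableEq V] {G : SimpleGraph V}
    {N T : Finset V} (hNT : Disjoint N T) {a m b : ℕ} (hN : N.card = a) (hT : T.card = b)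
    (hV : Fintype.card V = a + m + b) (X : SimpleGraph (Fin b)) (full : Prop)
    (hX : ∀ i j, X.Adj i j ↔ i ≠ j ∧ full)
    (h₁ : ∀ u v, u ∉ T → v ∉ T → u ≠ v → G.Adj u v)
    (h₂ : ∀ v ∉ T, ∀ u ∈ T, G.Adj u v ↔ v ∈ N)
    (h₃ : ∀ u ∈ T, ∀ w ∈ T, u ≠ w → (G.Adj u w ↔ full)) :
    Nonempty (G ≃g graphJoin (⊤ : SimpleGraph (Fin a))
      (SimpleGraph.sum (⊤ : SimpleGraph (Fin m)) X)) := by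
  have hM : (N ∪ T)ᶜ.card = m := by
    rw [Finset.card_compl, Finset.card_union_of_disjoint hNT]; omega
  let eN := (N.equivFinOfCardEq hN).symm
  let eM := ((N ∪ T)ᶜ.equivFinOfCardEq hM).symm
  let eT := (T.equivFinOfCardEq hT).symm
  have hNn : ∀ i, (eN i : V) ∉ T := fun i => Finset.disjoint_left.1 hNT (eN i).2
  have hMn : ∀ i, (eM i : V) ∉ N ∧ (eM i : V) ∉ T := fun i => by
    simpa using Finset.mem_compl.1 (eM i).2
  let f : Fin a ⊕ (Fin m ⊕ Fin b) → V :=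
    Sum.elim (fun i => eN i) (Sum.elim (fun i => eM i) fun i => eT i)
  have hinj : Function.Injective f := by
    rintro (i | i | i) (j | j | j) hij <;>
      simp only [f, Sum.elim_inl, Sum.elim_inr] at hij
    · rw [eN.injective (Subtype.ext hij)]
    · exact absurd (hij ▸ (eN i).2) (hMn j).1
    · exact absurd (hij ▸ (eT j).2) (hNn i)
    · exact absurd (hij ▸ (eN j).2) (hMn i).1
    · rw [eM.injective (Subtype.ext hij)]
    · exact absurd (hij ▸ (eT j).2) (hMn i).2
    · exact absurd (hij ▸ (eT i).2) (hNn j)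
    · exact absurd (hij ▸ (eT i).2) (hMn j).2
    · rw [eT.injective (Subtype.ext hij)]
  have hbij : Function.Bijective f := by
    rw [Fintype.bijective_iff_injective_and_card]
    refine ⟨hinj, ?_⟩
    simp only [Fintype.card_sum, Fintype.card_fin]
    omega
  refine ⟨SimpleGraph.Iso.symm ⟨Equiv.ofBijective f hbij, ?_⟩⟩
  intro x y
  rw [Equiv.ofBijective_apply, Equiv.ofBijective_apply]
  by_cases hxy : x = y
  · subst hxy; simp
  have hne : f x ≠ f y := fun h => hxy (hinj h)
  rcases x with (i | i | i) <;> rcases y with (j | j | j)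
  · simpa [graphJoin, f, hne, h₁ _ _ (hNn i) (hNn j) hne] using hxy
  · simpa [graphJoin, f] using h₁ _ _ (hNn i) (hMn j).2 hne
  · simpa [graphJoin, f] using ((h₂ _ (hNn i) _ (eT j).2).2 (eN i).2).symm
  · simpa [graphJoin, f] using h₁ _ _ (hMn i).2 (hNn j) hne
  · simpa [graphJoin, f, h₁ _ _ (hMn i).2 (hMn j).2 hne] using hxy
  · simpa [graphJoin, f, SimpleGraph.adj_comm] using
      fun h => (hMn i).1 ((h₂ _ (hMn i).2 _ (eT j).2).1 h)
  · simpa [graphJoin, f] using (h₂ _ (hNn j) _ (eT i).2).2 (eN j).2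
  · simpa [graphJoin, f] using fun h => (hMn j).1 ((h₂ _ (hMn j).2 _ (eT i).2).1 h)
  · have hij : i ≠ j := fun h => hxy (by rw [h])
    simpa [graphJoin, f, hX, hij] using h₃ _ (eT i).2 _ (eT j).2 hne

theorem theorem2p1 (k δ : ℕ) (hδ : k + 2 ≤ δ) :
    ∃ N : ℕ, ∀ n : ℕ, N ≤ n → ∀ (G : SimpleGraph (Fin n)) [DecidableRel G.Adj],
      δ ≤ G.minDegree → (n : ℝ) - δ + k - 1 ≤ adjSpectralRadius G →
      IsKEdgeHamiltonian k G ∨ Nonempty (G ≃g graphH n k δ) ∨ Nonempty (G ≃g graphL n k δ) := by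
  classical
  obtain ⟨c, hc⟩ : ∃ c, δ = c + k := ⟨δ - k, by omega⟩
  set b := 4 * (2 * c + 1) with hb
  -- The first terms serve `isClique_high_degree`. The products with c + 2 put l above b (k + b) and
  -- (2δ + 1) c δ, as the two eigenvector lemmas need. The last 2δ keeps the subtraction in the size
  -- of `graphH` from truncating.
  refine ⟨3 * b + 2 * k + 2 + (c + 2) + b * (k + b) + (2 * δ + 1) * (c * δ) + 2 * δ,
    fun n hn G inst hmin hspec => ?_⟩
  have hmul1 := Nat.zero_le (b * (k + b))
  have hmul2 := Nat.zero_le ((2 * δ + 1) * (c * δ))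
  set l := adjSpectralRadius G with hl
  have hlc : (n : ℝ) - c - 1 ≤ l := by
    rw [hc] at hspec
    push_cast at hspec
    linarith
  have hbig : ((b * (k + b) : ℕ) : ℝ) < l ∧ (((2 * δ + 1) * (c * δ) : ℕ) : ℝ) < l := by
    constructor
    · have : (b * (k + b)) + c + 2 ≤ n := by omega
      have : (((b * (k + b)) + c + 2 : ℕ) : ℝ) ≤ n := by exact_mod_cast this
      push_cast at this ⊢
      linarith
    · have : ((2 * δ + 1) * (c * δ)) + c + 2 ≤ n := by omega
      have : ((((2 * δ + 1) * (c * δ)) + c + 2 : ℕ) : ℝ) ≤ n := by exact_mod_cast this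
      push_cast at this ⊢
      linarith
  have hl0 : 0 < l := lt_of_le_of_lt (Nat.cast_nonneg _) hbig.1
  obtain ⟨x, hx, hx0, heig⟩ := exists_nonneg_eigenvector G hl0
  rw [← hl] at heig
  refine or_iff_not_imp_left.2 fun hnot => ?_
  unfold IsKEdgeHamiltonian at hnot
  push Not at hnot
  obtain ⟨F, hFG, hFk, hlin, hno⟩ := hnot
  have hcard : Fintype.card (Fin n) = n := Fintype.card_fin n
  have hn3 : 3 ≤ Fintype.card (Fin n) := by omega
  have hnoG : ¬ HasHamCycle G F := fun h => by
    obtain ⟨v, w, hw, hwF⟩ := h.exists_isHamiltonianCycle hn3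
    obtain ⟨e, he, he'⟩ := hno v w hw
    exact he' (hwF e he)
  obtain ⟨H, hGH, hmax⟩ :=
    (Set.toFinite {H : SimpleGraph (Fin n) | ¬ HasHamCycle H F}).exists_le_maximal hnoG
  replace hmax : Maximal (fun H => ¬ HasHamCycle H F) H := hmax
  have hFH : (F : Set (Sym2 (Fin n))) ⊆ H.edgeSet :=
    hFG.trans (SimpleGraph.edgeSet_mono hGH)
  have hdegle : ∀ v, G.degree v ≤ H.degree v := fun v => by
    rw [← SimpleGraph.card_neighborFinset_eq_degree, ← SimpleGraph.card_neighborFinset_eq_degree]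
    refine Finset.card_le_card fun w hw => ?_
    rw [SimpleGraph.mem_neighborFinset] at hw ⊢
    exact hGH hw
  have hsum : (Fintype.card (Fin n) - c - 1) ^ 2 ≤ ∑ v, H.degree v := by
    have h1 := sq_le_sum_degree_of_eigenvector G hx0 heig
    have h2 : ((n - c - 1 : ℕ) : ℝ) ≤ l := by
      rw [Nat.cast_sub (by omega), Nat.cast_sub (by omega)]
      push_cast
      exact hlc
    have h3 : (((n - c - 1) ^ 2 : ℕ) : ℝ) ≤ (∑ v, G.degree v : ℕ) := by
      push_cast
      exact (pow_le_pow_left₀ (Nat.cast_nonneg _) h2 2).trans h1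
    rw [hcard]
    exact (Nat.cast_le.1 h3).trans (Finset.sum_le_sum fun v _ => hdegle v)
  obtain ⟨hTb, hclique⟩ := isClique_high_degree H (k := k) (c := c) (by rw [hcard, ← hb]; omega)
    (fun u v huv hadj => by
      obtain ⟨p, hp, rfl, rfl⟩ := exists_isHamPath_of_maximal hn3 hFH hmax huv hadj
      exact (hp.degree_add_degree hmax.prop hFk).1) hsum
  rw [← hb] at hTb hclique
  set T := Finset.univ.filter fun v => H.degree v ≤ k + b with hT
  have hTmem : ∀ v, v ∈ T ↔ H.degree v ≤ k + b := fun v => by simp [hT]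
  replace hclique : ∀ u v, u ∉ T → v ∉ T → u ≠ v → H.Adj u v := fun u v hu hv huv =>
    hclique u v huv (not_le.1 ((hTmem u).not.1 hu)) (not_le.1 ((hTmem v).not.1 hv))
  -- T is defined by degrees in H, but the eigenvector is that of G; this is harmless since degrees
  -- in G are no larger.
  have hTc : T.card ≤ c := by
    refine card_low_degree_le hx hx0 heig (D := k + b)
      (fun u hu => (hdegle u).trans ((hTmem u).1 hu)) (lt_of_le_of_lt ?_ hbig.1) ?_
    · rw [Nat.cast_mul]
      gcongr
    · rw [hcard]; exact hlc
  have hT0 : T.Nonempty := by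
    by_contra h
    rw [Finset.not_nonempty_iff_eq_empty] at h
    have htop : H = ⊤ := by
      refine eq_top_iff.2 fun u v huv => hclique u v ?_ ?_ huv.ne <;> simp [h]
    refine hmax.prop (htop ▸ hlin.hasHamCycle_top (by omega) fun e he => ?_)
    exact G.not_isDiag_of_mem_edgeSet (hFG he)
  obtain ⟨hTk, hTdeg, N, hdisj, hNadj, hN⟩ := exists_structure_of_maximal hn3 hFH hmax hFk
    (fun v => (hmin.trans (G.minDegree_le_degree v)).trans (hdegle v)) hclique hT0 (by omega)
    (fun u hu => by
      have := (hTmem u).1 hu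
      rw [hcard]; omega)
  have hTc' : T.card = c := by omega
  -- no edge of `H` is missing in `G`
  have hGT : ∀ u ∈ T, ∀ w, G.Adj u w ↔ H.Adj u w := by
    intro u hu w
    have hsub : G.neighborFinset u ⊆ H.neighborFinset u := fun w hw => by
      rw [SimpleGraph.mem_neighborFinset] at hw ⊢
      exact hGH hw
    have := Finset.eq_of_subset_of_card_le hsub (by
      rw [SimpleGraph.card_neighborFinset_eq_degree, SimpleGraph.card_neighborFinset_eq_degree,
        hTdeg u hu]
      exact hmin.trans (G.minDegree_le_degree u))
    rw [← SimpleGraph.mem_neighborFinset, this, SimpleGraph.mem_neighborFinset]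
  -- Now |T| is exactly c, so l is at least the eigenvalue of a clique on the complement of T.
  have hGK : ∀ u v, u ∉ T → v ∉ T → u ≠ v → G.Adj u v := by
    intro u v hu hv huv
    refine adj_of_eigenvector hx hx0 heig (T := T) (D := δ)
      (fun u hu => (hdegle u).trans (hTdeg u hu).le) (lt_of_le_of_lt ?_ hbig.2) ?_ hu hv huv
    · rw [hTc']; push_cast; exact le_rfl
    · rw [hcard, hTc']; exact hlc
  have hGN : ∀ v ∉ T, ∀ u ∈ T, G.Adj u v ↔ v ∈ N := fun v hv u hu =>
    (hGT u hu v).trans (hNadj v hv u hu)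
  rcases hN with ⟨hNc, hind⟩ | ⟨hNc, hcomp⟩
  · left
    refine nonempty_iso_graphJoin hdisj hNc (by omega) (by rw [hcard]; omega) _ False (by simp)
      hGK hGN fun u hu w hw _ => ?_
    rw [hGT u hu w]
    exact iff_false_intro (hind u hu w hw)
  · right
    refine nonempty_iso_graphJoin hdisj hNc (by omega) (by rw [hcard]; omega) _ True (by simp)
      hGK hGN fun u hu w hw huw => ?_
    rw [hGT u hu w]
    exact iff_true_intro (hcomp u hu w hw huw)
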